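/- Let $N\ge 1$, let $\mathcal E_1\le\dots\le\mathcal E_N$ be real numbers with $\sum_k\mathcal E_k=0$, and put $A=-i\,\mathrm{diag}(\mathcal E_1,\dots,\mathcal E_N)$. Let $B=(b_{ij})\in\mathfrak{su}(N)$, i.e. $B$ is a traceless skew-Hermitian $N\times N$ matrix. Consider the control system $$\dot X(t)=(A+u(t)B)X(t),\qquad X(t)\in SU(N),\quad X(0)=I,$$ with piecewise constant inputs $u$ taking real values. It is called controllable if every element of $SU(N)$ is of the form $X(T)$ for some such input and some $T\ge 0$. Let $\mathcal G_B$ be the graph on $\{1,\dots,N\}$ in which distinct $i,j$ are joined when $b_{ij}\ne 0$. Let $C=[A,B]$, $D=[C,B]=[[A,B],B]$, and let $D_0$ be the diagonal part of $D$. For a diagonal matrix $H=\mathrm{diag}(h_1,\dots,h_N)$ put $\alpha_{ij}(H)=h_i-h_j$. Call $H$ regular if the numbers $\alpha_{ij}(H)$, over all ordered pairs $(i,j)$ with $i\neq j$, are nonzero and pairwise distinct. For a matrix $M=(m_{ij})$, call $H$ $M$-regular if the numbers $\alpha_{ij}(H)$, over all pairs $i<j$ with $m_{ij}\ne 0$,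 are nonzero and pairwise distinct. Assume that $\mathcal E_i\neq\mathcal E_j$ for $i\ne j$ and that $\mathcal G_B$ is connected. Then $D_0=i\,\mathrm{diag}(d_1,\dots,d_N)$ with $$d_k=2\Big(\sum_{i<k}(\mathcal E_k-\mathcal E_i)|b_{ik}|^2-\sum_{i>k}(\mathcal E_i-\mathcal E_k)|b_{ki}|^2\Big),$$ and each of the following conditions is sufficient for the system to be controllable: (1) $D_0$ is regular; (2) $D_0$ is $B$-regular; (3) $D_0$ is $C$-regular. -/

import Mathlib

namespace QuantumControl

/-- The real Lie algebra `su(N)`, as a set: the traceless skew-Hermitian `N × N` matrices. -/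
def su (N : ℕ) : Set (Matrix (Fin N) (Fin N) ℂ) :=
  {M | M.conjTranspose = -M ∧ M.trace = 0}

/-- The drift `A = -i H₀`, where `H₀ = diag(E₁, …, E_N)` is the free Hamiltonian. -/
noncomputable def drift {N : ℕ} (E : Fin N → ℝ) : Matrix (Fin N) (Fin N) ℂ :=
  (-Complex.I) • Matrix.diagonal (fun k => (E k : ℂ))

/-- The graph of a (skew-Hermitian) matrix `M`: the nodes are the indices, and distinct nodes
`i`, `j` are joined when `M i j ≠ 0` (equivalently `M j i ≠ 0`, as `M` is skew-Hermitian). -/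
def graph {N : ℕ} (M : Matrix (Fin N) (Fin N) ℂ) : SimpleGraph (Fin N) :=
  SimpleGraph.fromRel (fun i j => M i j ≠ 0)

/-- The value at the diagonal matrix `H` of the root `α_{ij} = α_i - α_j`,
where `α_i (diag (l₁, …, l_N)) = l_i`. -/
def root {N : ℕ} (i j : Fin N) (H : Matrix (Fin N) (Fin N) ℂ) : ℂ :=
  H i i - H j j

/-- A diagonal matrix `H` is regular: all the roots `α_{ij}`, `i ≠ j`, positive and negative,
take nonzero and pairwise distinct values at `H`. -/
def IsRegular {N : ℕ} (H : Matrix (Fin N) (Fin N) ℂ) : Prop :=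
  (∀ i j : Fin N, i ≠ j → root i j H ≠ 0) ∧
  ∀ i j k l : Fin N, i ≠ j → k ≠ l → (i, j) ≠ (k, l) → root i j H ≠ root k l H

/-- The set `Γ⁺` of the positive roots `α_{ij}`, `i < j`, that are touched by `M`. -/
def posRoots {N : ℕ} (M : Matrix (Fin N) (Fin N) ℂ) : Set (Fin N × Fin N) :=
  {p | p.1 < p.2 ∧ M p.1 p.2 ≠ 0}

/-- A diagonal matrix `H` is `M`-regular: the roots in the set `Γ⁺` of `M` take nonzero and
pairwise distinct values at `H`. -/
def IsRegularAlong {N : ℕ} (M H : Matrix (Fin N) (Fin N) ℂ) : Prop :=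
  (∀ p ∈ posRoots M, root p.1 p.2 H ≠ 0) ∧
  ∀ p ∈ posRoots M, ∀ q ∈ posRoots M, p ≠ q → root p.1 p.2 H ≠ root q.1 q.2 H

/-- The level one bracket `C = [A, B]`. -/
def levelOne {N : ℕ} (A B : Matrix (Fin N) (Fin N) ℂ) : Matrix (Fin N) (Fin N) ℂ :=
  ⁅A, B⁆

/-- The level two bracket `D = [C, B] = [[A, B], B]`. -/
def levelTwo {N : ℕ} (A B : Matrix (Fin N) (Fin N) ℂ) : Matrix (Fin N) (Fin N) ℂ :=
  ⁅levelOne A B, B⁆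

/-- The diagonal part `D₀` of the level two bracket `D`. -/
def levelTwoDiag {N : ℕ} (A B : Matrix (Fin N) (Fin N) ℂ) : Matrix (Fin N) (Fin N) ℂ :=
  Matrix.diagonal (levelTwo A B).diag

/-- `d_k = 2 (∑_{i<k} (E_k - E_i) |b_{ik}|² - ∑_{i>k} (E_i - E_k) |b_{ki}|²)`. -/
noncomputable def dEntry {N : ℕ} (E : Fin N → ℝ) (B : Matrix (Fin N) (Fin N) ℂ) (k : Fin N) : ℝ :=
  2 * (∑ i ∈ Finset.univ.filter (fun i => i < k), (E k - E i) * ‖B i k‖ ^ 2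
    - ∑ i ∈ Finset.univ.filter (fun i => k < i), (E i - E k) * ‖B k i‖ ^ 2)

/-- The admissible inputs: piecewise constant real functions (with finitely many pieces).
A larger class of inputs could only enlarge the reachable set, so controllability with these
inputs is the strongest form of controllability. -/
def IsAdmissible (u : ℝ → ℝ) : Prop :=
  ∃ S : Finset ℝ, ∀ s t : ℝ, s ≤ t → (∀ r ∈ S, r ∉ Set.Icc s t) → u s = u t

/-- `X : [0, T] → SU(N)` is an integral curve of `X' = (A + u(t) B) X`, `X(0) = I`: it is
continuous on `[0, T]`, and the differential equation holds (entry by entry) at all times in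
`(0, T)` outside a finite set. The values of `X` outside `[0, T]` are irrelevant. -/
def IsIntegralCurve {N : ℕ} (A B : Matrix (Fin N) (Fin N) ℂ) (u : ℝ → ℝ) (T : ℝ)
    (X : ℝ → Matrix.specialUnitaryGroup (Fin N) ℂ) : Prop :=
  X 0 = 1 ∧ ContinuousOn X (Set.Icc 0 T) ∧
  ∃ S : Finset ℝ, ∀ t ∈ Set.Ioo 0 T, t ∉ S → ∀ i j : Fin N,
    HasDerivAt (fun s : ℝ => (X s : Matrix (Fin N) (Fin N) ℂ) i j)
      (((A + (u t : ℂ) • B) * (X t : Matrix (Fin N) (Fin N) ℂ)) i j) t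

/-- The reachable set from the identity, in arbitrary time `T ≥ 0`. -/
def reachableSet {N : ℕ} (A B : Matrix (Fin N) (Fin N) ℂ) :
    Set (Matrix.specialUnitaryGroup (Fin N) ℂ) :=
  {Y | ∃ u : ℝ → ℝ, IsAdmissible u ∧ ∃ T : ℝ, 0 ≤ T ∧
    ∃ X : ℝ → Matrix.specialUnitaryGroup (Fin N) ℂ, IsIntegralCurve A B u T X ∧ X T = Y}

/-- The system `X' = (A + u(t) B) X`, `X(0) = I`, on `SU(N)` is (globally) controllable:
its reachable set is all of `SU(N)`. -/
def IsControllable {N : ℕ} (A B : Matrix (Fin N) (Fin N) ℂ) : Prop :=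
  reachableSet A B = Set.univ

end QuantumControl

/-!
Over `ℂ`, polynomials in `ad A` act on the entries of a matrix through the energy gaps, so the Lie
algebra generated by `A` and `B` contains `D₀` in its complexification. Applying the functional
calculus of `ad A` and of `ad D₀` to `B` isolates each nonzero off-diagonal entry of `B`; the
resulting elementary matrices along the edges of the connected graph generate `sl(N, ℂ)`, and the
skew-Hermitian part of the Lie algebra is `su(N)`.

By this rank condition, suitable products of forward flows `exp (t (A + u B))`, `t ≥ 0`, cover an
open subset of `SU(N)`. Inverses come for free: in a compact group the powers of `g` return close
to `g⁻¹`, so a submonoid with nonempty interior is a neighbourhood of the identity, hence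
everything by connectedness.
-/

namespace QuantumControl

open Matrix Filter Topology
open NormedSpace (exp)
open scoped Matrix.Norms.L2Operator Pointwise

attribute [local instance] LieRing.ofAssociativeRing

section AdDiagonal

variable {n R K : Type*} [Fintype n] [DecidableEq n] [CommRing R] [Field K]

theorem lie_diagonal_apply (h : n → R) (X : Matrix n n R) (i j : n) :
    ⁅diagonal h, X⁆ i j = (h i - h j) * X i j := by
  rw [Ring.lie_def, Matrix.sub_apply, diagonal_mul, mul_diagonal]
  ring

theorem of_eval_sub_mul_mem {V : Submodule R (Matrix n n R)} {h : n → R}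
    (hV : ∀ X ∈ V, ⁅diagonal h, X⁆ ∈ V) {X : Matrix n n R} (hX : X ∈ V) (p : Polynomial R) :
    of (fun i j => p.eval (h i - h j) * X i j) ∈ V := by
  induction p using Polynomial.induction_on with
  | C a =>
    convert V.smul_mem a hX using 1
    ext i j
    simp
  | add p q hp hq =>
    convert V.add_mem hp hq using 1
    ext i j
    simp [add_mul]
  | monomial k a ih =>
    convert hV _ ih using 1
    ext i j
    simp only [lie_diagonal_apply, of_apply, Polynomial.eval_mul, Polynomial.eval_C,
      Polynomial.eval_pow, Polynomial.eval_X]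
    ring

theorem of_apply_sub_mul_mem {V : Submodule K (Matrix n n K)} {h : n → K}
    (hV : ∀ X ∈ V, ⁅diagonal h, X⁆ ∈ V) {X : Matrix n n K} (hX : X ∈ V) (f : K → K) :
    of (fun i j => f (h i - h j) * X i j) ∈ V := by
  classical
  set gaps : Finset K := Finset.univ.image fun p : n × n => h p.1 - h p.2
  convert of_eval_sub_mul_mem hV hX (Lagrange.interpolate gaps id f) using 1
  ext i j
  have hgap : h i - h j ∈ gaps :=
    Finset.mem_image_of_mem (fun p : n × n => h p.1 - h p.2) (Finset.mem_univ (i, j))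
  have hnode := Lagrange.eval_interpolate_at_node f (Set.injOn_id _) hgap
  simp only [of_apply, id] at hnode ⊢
  rw [hnode]

theorem diagonal_diag_mem {V : Submodule K (Matrix n n K)} {h : n → K}
    (hinj : Function.Injective h) (hV : ∀ X ∈ V, ⁅diagonal h, X⁆ ∈ V) {X : Matrix n n K}
    (hX : X ∈ V) : diagonal X.diag ∈ V := by
  classical
  convert of_apply_sub_mul_mem hV hX (fun z => if z = 0 then 1 else 0) using 1
  ext i j
  simp only [of_apply, sub_eq_zero, hinj.eq_iff, diagonal_apply, diag_apply]
  split_ifs with hij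
  · rw [hij, one_mul]
  · rw [zero_mul]

theorem single_mem_of_separated {L : LieSubalgebra K (Matrix n n K)} {h d : n → K}
    (hh : diagonal h ∈ L) (hd : diagonal d ∈ L) {X : Matrix n n K} (hX : X ∈ L) {i j : n}
    (hij : X i j ≠ 0)
    (hsep : ∀ k l, X k l ≠ 0 → h i - h j = h k - h l → d i - d j = d k - d l → i = k ∧ j = l) :
    single i j 1 ∈ L := by
  classical
  have hXh := of_apply_sub_mul_mem (V := L.toSubmodule) (fun _ hY => L.lie_mem hh hY) hX
    (fun z => if h i - h j = z then 1 else 0)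
  have hXhd := of_apply_sub_mul_mem (V := L.toSubmodule) (fun _ hY => L.lie_mem hd hY) hXh
    (fun z => if d i - d j = z then (X i j)⁻¹ else 0)
  rw [← LieSubalgebra.mem_toSubmodule]
  convert hXhd using 1
  ext k l
  simp only [of_apply, single_apply]
  by_cases hkl : i = k ∧ j = l
  · obtain ⟨rfl, rfl⟩ := hkl
    simp [hij]
  · rw [if_neg hkl]
    split_ifs with hdkl hhkl <;> simp only [mul_zero, zero_mul, one_mul]
    have hXkl : X k l = 0 := by_contra fun hne => hkl (hsep k l hne hhkl hdkl)
    rw [hXkl, mul_zero]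

theorem single_mem_of_reachable {L : LieSubalgebra R (Matrix n n R)} {G : SimpleGraph n}
    (hL : ∀ i j, G.Adj i j → single i j (1 : R) ∈ L) {i j : n} (hij : G.Reachable i j)
    (hne : i ≠ j) : single i j (1 : R) ∈ L := by
  obtain ⟨w⟩ := hij
  induction w with
  | nil => exact absurd rfl hne
  | @cons i k j hik _ ih =>
    rcases eq_or_ne k j with rfl | hkj
    · exact hL _ _ hik
    · simpa [Ring.lie_def, single_mul_single_of_ne _ _ _ _ hne.symm]
        using L.lie_mem (hL _ _ hik) (ih hkj)

theorem eq_sum_smul_single_sub_of_trace_eq_zero (o : n) {X : Matrix n n R} (hX : X.trace = 0) :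
    X = ∑ i, ∑ j, X i j • (single i j (1 : R) - if i = j then single o o 1 else 0) := by
  have htrace : ∑ i, X i i = 0 := hX
  simp only [smul_sub, Finset.sum_sub_distrib, smul_ite, smul_zero, Finset.sum_ite_eq,
    Finset.mem_univ, if_true, ← Finset.sum_smul, htrace, zero_smul, sub_zero]
  conv_lhs => rw [matrix_eq_sum_single X]
  simp

theorem mem_of_trace_eq_zero_of_connected {L : LieSubalgebra R (Matrix n n R)}
    {G : SimpleGraph n} (hG : G.Connected) (hL : ∀ i j, G.Adj i j → single i j (1 : R) ∈ L)
    {X : Matrix n n R} (hX : X.trace = 0) : X ∈ L := by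
  have hoff : ∀ i j, i ≠ j → single i j (1 : R) ∈ L := fun i j =>
    single_mem_of_reachable hL (hG.preconnected i j)
  obtain ⟨o⟩ := hG.nonempty
  have hdiag : ∀ i, single i i (1 : R) - single o o 1 ∈ L := by
    intro i
    rcases eq_or_ne i o with rfl | hi
    · simp
    · simpa [Ring.lie_def] using L.lie_mem (hoff _ _ hi) (hoff _ _ hi.symm)
  rw [eq_sum_smul_single_sub_of_trace_eq_zero o hX]
  refine L.toSubmodule.sum_mem fun i _ => L.toSubmodule.sum_mem fun j _ =>
    L.toSubmodule.smul_mem _ ?_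
  rcases eq_or_ne i j with rfl | hij
  · simpa using hdiag i
  · simpa [hij] using hoff _ _ hij

end AdDiagonal

section Complexification

variable {𝔤 : Type*} [LieRing 𝔤] [LieAlgebra ℝ 𝔤] [LieAlgebra ℂ 𝔤] [IsScalarTower ℝ ℂ 𝔤]

/-- The complexification `L + iL` of a real Lie subalgebra `L` of a complex Lie algebra, formed
inside that algebra; the sum need not be direct. -/
def complexify (L : LieSubalgebra ℝ 𝔤) : LieSubalgebra ℂ 𝔤 where
  carrier := {X | ∃ a ∈ L, ∃ b ∈ L, X = a + Complex.I • b}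
  zero_mem' := ⟨0, L.zero_mem, 0, L.zero_mem, by simp⟩
  add_mem' := by
    rintro _ _ ⟨a, ha, b, hb, rfl⟩ ⟨a', ha', b', hb', rfl⟩
    exact ⟨_, L.add_mem ha ha', _, L.add_mem hb hb', by module⟩
  smul_mem' := by
    rintro z _ ⟨a, ha, b, hb, rfl⟩
    refine ⟨z.re • a - z.im • b, L.sub_mem (L.smul_mem _ ha) (L.smul_mem _ hb),
      z.re • b + z.im • a, L.add_mem (L.smul_mem _ hb) (L.smul_mem _ ha), ?_⟩
    simp only [← algebraMap_smul ℂ z.re, ← algebraMap_smul ℂ z.im, Complex.coe_algebraMap]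
    conv_lhs => rw [← Complex.re_add_im z]
    match_scalars
    · ring
    · linear_combination (z.im : ℂ) * Complex.I_mul_I
  lie_mem' := by
    rintro _ _ ⟨a, ha, b, hb, rfl⟩ ⟨a', ha', b', hb', rfl⟩
    refine ⟨⁅a, a'⁆ - ⁅b, b'⁆, L.sub_mem (L.lie_mem ha ha') (L.lie_mem hb hb'),
      ⁅a, b'⁆ + ⁅b, a'⁆, L.add_mem (L.lie_mem ha hb') (L.lie_mem hb ha'), ?_⟩
    simp only [add_lie, lie_add, smul_lie, lie_smul, smul_add, smul_smul, Complex.I_mul_I]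
    module

theorem mem_complexify_of_mem {L : LieSubalgebra ℝ 𝔤} {X : 𝔤} (hX : X ∈ L) :
    X ∈ complexify L :=
  ⟨X, hX, 0, L.zero_mem, by simp⟩

theorem mem_of_mem_complexify_of_star_eq_neg [StarAddMonoid 𝔤] [StarModule ℂ 𝔤]
    {L : LieSubalgebra ℝ 𝔤} (hL : ∀ X ∈ L, star X = -X) {X : 𝔤} (hX : X ∈ complexify L)
    (hstar : star X = -X) : X ∈ L := by
  obtain ⟨a, ha, b, hb, rfl⟩ := hX
  have hb0 : (2 * Complex.I) • b = 0 := by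
    rw [star_add, star_smul, hL a ha, hL b hb, Complex.star_def, Complex.conj_I,
      neg_smul_neg, neg_add, add_right_inj, ← add_eq_zero_iff_eq_neg] at hstar
    rw [← hstar]
    module
  have : b = 0 := (smul_eq_zero.1 hb0).resolve_left (by simp)
  simpa [this] using ha

end Complexification

section RankCondition

variable {N : ℕ} {E : Fin N → ℝ} {B H : Matrix (Fin N) (Fin N) ℂ}

theorem graph_adj_iff (hB : Bᴴ = -B) {i j : Fin N} : (graph B).Adj i j ↔ i ≠ j ∧ B i j ≠ 0 := by
  have hsymm : B j i = 0 ↔ B i j = 0 := by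
    have hji : star (B i j) = -B j i := congrFun₂ hB j i
    rw [← neg_eq_zero, ← hji, star_eq_zero]
  simp [graph, SimpleGraph.fromRel_adj, hsymm]

/-- The energies `E` and the diagonal matrix `H` together separate the edges of `G`: no two
oriented edges have both the same energy gap and the same root value at `H`. Each of the three
regularity conditions on `H` is a special case. -/
def SeparatesEdges (G : SimpleGraph (Fin N)) (E : Fin N → ℝ) (H : Matrix (Fin N) (Fin N) ℂ) :
    Prop :=
  ∀ i j k l, G.Adj i j → G.Adj k l → E i - E j = E k - E l → root i j H = root k l H →
    i = k ∧ j = l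

theorem IsRegular.separatesEdges (h : IsRegular H) (G : SimpleGraph (Fin N)) (E : Fin N → ℝ) :
    SeparatesEdges G E H := fun i j k l hij hkl _ hroot =>
  Prod.mk_inj.1 (by_contra fun hne => h.2 i j k l hij.ne hkl.ne hne hroot)

theorem IsRegularAlong.separatesEdges (h : IsRegularAlong B H) (hB : Bᴴ = -B)
    (hE : StrictMono E) : SeparatesEdges (graph B) E H := by
  have hpos : ∀ {i j k l}, (graph B).Adj i j → (graph B).Adj k l → i < j →
      E i - E j = E k - E l → root i j H = root k l H → i = k ∧ j = l := by
    intro i j k l hij hkl hlt hgap hroot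
    have hlt' : k < l := hE.lt_iff_lt.1 (by linarith [hE hlt])
    exact Prod.mk_inj.1 (by_contra fun hne => h.2 (i, j) ⟨hlt, ((graph_adj_iff hB).1 hij).2⟩
      (k, l) ⟨hlt', ((graph_adj_iff hB).1 hkl).2⟩ hne hroot)
  intro i j k l hij hkl hgap hroot
  rcases lt_or_gt_of_ne hij.ne with hlt | hlt
  · exact hpos hij hkl hlt hgap hroot
  · have hroot' : root j i H = root l k H := by
      rw [root, ← neg_sub, ← root, hroot, root, neg_sub, ← root]
    exact (hpos hij.symm hkl.symm hlt (by linarith) hroot').symm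

theorem drift_eq_diagonal (E : Fin N → ℝ) :
    drift E = diagonal fun k => -Complex.I * (E k : ℂ) := by
  rw [drift, ← diagonal_smul]
  rfl

theorem drift_sub_drift (E : Fin N → ℝ) (i j : Fin N) :
    -Complex.I * (E i : ℂ) - -Complex.I * (E j : ℂ) = -Complex.I * ((E i - E j : ℝ) : ℂ) := by
  push_cast
  ring

theorem drift_mem_su (hE : ∑ k, E k = 0) : drift E ∈ su N := by
  constructor
  · rw [drift_eq_diagonal, diagonal_conjTranspose, diagonal_neg]
    congr 1
    ext k
    simp
  · rw [drift_eq_diagonal, trace_diagonal, ← Finset.mul_sum, ← Complex.ofReal_sum, hE,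
      Complex.ofReal_zero, mul_zero]

theorem posRoots_levelOne (hE : Function.Injective E) (B : Matrix (Fin N) (Fin N) ℂ) :
    posRoots (levelOne (drift E) B) = posRoots B := by
  ext ⟨i, j⟩
  refine and_congr_right fun (hij : i < j) => ?_
  have hgap : E i - E j ≠ 0 := sub_ne_zero.2 (hE.ne hij.ne)
  simp [levelOne, drift_eq_diagonal, lie_diagonal_apply, drift_sub_drift, hgap, -neg_mul,
    -Complex.ofReal_sub]

theorem isRegularAlong_levelOne_iff (hE : Function.Injective E) :
    IsRegularAlong (levelOne (drift E) B) H ↔ IsRegularAlong B H := by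
  rw [IsRegularAlong, posRoots_levelOne hE, IsRegularAlong]

/-- `su(N)` as a real Lie subalgebra of `gl(N, ℂ)`. -/
def suLie (N : ℕ) : LieSubalgebra ℝ (Matrix (Fin N) (Fin N) ℂ) where
  carrier := su N
  zero_mem' := by simp [su]
  add_mem' := by
    rintro X Y ⟨hX, hX'⟩ ⟨hY, hY'⟩
    exact ⟨by rw [conjTranspose_add, hX, hY, neg_add], by rw [trace_add, hX', hY', add_zero]⟩
  smul_mem' := by
    rintro r X ⟨hX, hX'⟩
    exact ⟨by rw [conjTranspose_smul, hX, star_trivial, smul_neg],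
      by rw [trace_smul, hX', smul_zero]⟩
  lie_mem' := by
    rintro X Y ⟨hX, -⟩ ⟨hY, -⟩
    exact ⟨by simp [Ring.lie_def, hX, hY],
      by rw [Ring.lie_def, trace_sub, trace_mul_comm, sub_self]⟩

theorem suLie_le_lieSpan (hE : ∑ k, E k = 0) (hinj : Function.Injective E) (hB : B ∈ su N)
    (hG : (graph B).Connected)
    (hsep : SeparatesEdges (graph B) E (levelTwoDiag (drift E) B)) :
    suLie N ≤ LieSubalgebra.lieSpan ℝ (Matrix (Fin N) (Fin N) ℂ) {drift E, B} := by
  set L := LieSubalgebra.lieSpan ℝ (Matrix (Fin N) (Fin N) ℂ) {drift E, B}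
  have hLsu : L ≤ suLie N :=
    LieSubalgebra.lieSpan_le.2 (Set.pair_subset (drift_mem_su hE) hB)
  have hAL : drift E ∈ L := LieSubalgebra.subset_lieSpan (Set.mem_insert _ _)
  have hBL : B ∈ L := LieSubalgebra.subset_lieSpan (Set.mem_insert_of_mem _ rfl)
  have hA : diagonal (fun k => -Complex.I * (E k : ℂ)) ∈ complexify L :=
    drift_eq_diagonal E ▸ mem_complexify_of_mem hAL
  have hinj' : Function.Injective fun k => -Complex.I * (E k : ℂ) := fun i j hij =>
    hinj (Complex.ofReal_injective (mul_left_cancel₀ (neg_ne_zero.2 Complex.I_ne_zero) hij))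
  have hD₀ : levelTwoDiag (drift E) B ∈ complexify L :=
    diagonal_diag_mem (V := (complexify L).toSubmodule) hinj'
      (fun _ hX => (complexify L).lie_mem hA hX)
      (mem_complexify_of_mem (L.lie_mem (L.lie_mem hAL hBL) hBL))
  have hedge : ∀ i j, (graph B).Adj i j → single i j (1 : ℂ) ∈ complexify L := by
    intro i j hij
    refine single_mem_of_separated hA hD₀ (mem_complexify_of_mem hBL)
      ((graph_adj_iff hB.1).1 hij).2 fun k l hkl hgap hroot => ?_
    rw [drift_sub_drift, drift_sub_drift] at hgap
    have hgap' : E i - E j = E k - E l := Complex.ofReal_injective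
      (mul_left_cancel₀ (neg_ne_zero.2 Complex.I_ne_zero) hgap)
    have hne : k ≠ l := by
      rintro rfl
      exact hij.ne (hinj (sub_eq_zero.1 (hgap'.trans (sub_self _))))
    exact hsep i j k l hij ((graph_adj_iff hB.1).2 ⟨hne, hkl⟩) hgap'
      (by simpa [root, levelTwoDiag] using hroot)
  exact fun X hX => mem_of_mem_complexify_of_star_eq_neg (fun Y hY => (hLsu hY).1)
    (mem_of_trace_eq_zero_of_connected hG hedge hX.2) hX.1

end RankCondition

section DiagonalFormula

variable {N : ℕ} {B : Matrix (Fin N) (Fin N) ℂ}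

theorem norm_apply_comm_of_skew (hB : Bᴴ = -B) (i j : Fin N) : ‖B j i‖ = ‖B i j‖ := by
  have hji : star (B i j) = -B j i := congrFun₂ hB j i
  rw [← norm_neg, ← hji, norm_star]

theorem dEntry_eq_sum (E : Fin N → ℝ) (hB : Bᴴ = -B) (k : Fin N) :
    dEntry E B k = 2 * ∑ i, (E k - E i) * ‖B i k‖ ^ 2 := by
  rw [dEntry, sub_eq_add_neg, ← Finset.sum_neg_distrib, Finset.sum_filter, Finset.sum_filter,
    ← Finset.sum_add_distrib]
  congr 1
  refine Finset.sum_congr rfl fun i _ => ?_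
  rcases lt_trichotomy i k with h | rfl | h
  · simp [h, h.le]
  · simp
  · simp only [h, h.not_gt, if_true, if_false, norm_apply_comm_of_skew hB i k]
    ring

theorem levelTwo_drift_apply_self (E : Fin N → ℝ) (B : Matrix (Fin N) (Fin N) ℂ) (k : Fin N) :
    levelTwo (drift E) B k k = -2 * Complex.I * ∑ i, (E k - E i) * (B k i * B i k) := by
  rw [levelTwo, Ring.lie_def, Matrix.sub_apply, Matrix.mul_apply, Matrix.mul_apply,
    ← Finset.sum_sub_distrib, Finset.mul_sum]
  refine Finset.sum_congr rfl fun i _ => ?_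
  rw [levelOne, drift_eq_diagonal, lie_diagonal_apply, lie_diagonal_apply]
  ring

theorem levelTwoDiag_drift (E : Fin N → ℝ) (hB : Bᴴ = -B) :
    levelTwoDiag (drift E) B = Complex.I • diagonal (fun k => (dEntry E B k : ℂ)) := by
  have hmul : ∀ i k, B k i * B i k = -(‖B i k‖ : ℂ) ^ 2 := by
    intro i k
    have hki : star (B i k) = -B k i := congrFun₂ hB k i
    rw [← Complex.conj_mul', ← Complex.star_def, hki]
    ring
  rw [levelTwoDiag, ← diagonal_smul]
  congr 1
  ext k
  rw [diag_apply, levelTwo_drift_apply_self, Pi.smul_apply, dEntry_eq_sum E hB, smul_eq_mul]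
  push_cast
  simp only [hmul, mul_neg, Finset.sum_neg_distrib]
  ring

end DiagonalFormula

section CompactGroup

variable {G : Type*} [Group G] [TopologicalSpace G] [IsTopologicalGroup G] {S : Submonoid G}

/-- Powers of a point `g` of the interior return close to `g⁻¹`. -/
theorem submonoid_mem_nhds_one [CompactSpace G] (hS : (interior (S : Set G)).Nonempty) :
    (S : Set G) ∈ 𝓝 1 := by
  obtain ⟨g, hg⟩ := hS
  have hinv : (interior (S : Set G))⁻¹ ∈ 𝓝 (g ^ (-1 : ℤ)) := by
    rw [_root_.zpow_neg_one]
    exact isOpen_interior.inv.mem_nhds (Set.inv_mem_inv.2 hg)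
  obtain ⟨k, hk⟩ := ((mapClusterPt_self_zpow_atTop_pow g (-1)).frequently hinv).exists
  have hpow : g ^ k ∈ S := S.pow_mem (interior_subset hg) k
  have hone : (1 : G) ∈ g ^ k • interior (S : Set G) := by
    rw [Set.mem_smul_set_iff_inv_smul_mem, smul_eq_mul, mul_one]
    exact hk
  refine mem_of_superset ((isOpen_interior.smul (g ^ k)).mem_nhds hone) ?_
  rintro _ ⟨s, hs, rfl⟩
  exact S.mul_mem hpow (interior_subset hs)

theorem submonoid_eq_top_of_mem_nhds_one [PreconnectedSpace G] (hS : (S : Set G) ∈ 𝓝 1) :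
    S = ⊤ := by
  let H : Subgroup G :=
    { S ⊓ S⁻¹ with
      inv_mem' := fun hx => ⟨hx.2, by simpa using hx.1⟩ }
  have hH : (H : Set G) ∈ 𝓝 1 := inter_mem hS (inv_mem_nhds_one G hS)
  have hopen : IsOpen (H : Set G) := H.isOpen_of_mem_nhds hH
  have huniv : (H : Set G) = Set.univ :=
    IsClopen.eq_univ ⟨H.isClosed_of_isOpen hopen, hopen⟩ ⟨1, H.one_mem⟩
  exact eq_top_iff.2 fun x _ => (huniv ▸ Set.mem_univ x : x ∈ (H : Set G)).1

theorem submonoid_eq_top_of_interior_nonempty [CompactSpace G] [PreconnectedSpace G]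
    (hS : (interior (S : Set G)).Nonempty) : S = ⊤ :=
  submonoid_eq_top_of_mem_nhds_one (submonoid_mem_nhds_one hS)

end CompactGroup

section SpecialUnitaryGroup

variable {n : Type*} [Fintype n] [DecidableEq n]

instance {R : Type*} [CommRing R] [StarRing R] [TopologicalSpace R] [IsTopologicalRing R]
    [ContinuousStar R] : IsTopologicalGroup (specialUnitaryGroup n R) where
  continuous_inv := Continuous.subtype_mk continuous_subtype_val.star _

instance {𝕜 : Type*} [RCLike 𝕜] : CompactSpace (specialUnitaryGroup n 𝕜) := by
  refine isCompact_iff_compactSpace.1 (IsCompact.of_isClosed_subset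
    (isCompact_univ_pi fun _ => isCompact_univ_pi fun _ => isCompact_closedBall (0 : 𝕜) 1) ?_
    fun U hU i _ j _ => mem_closedBall_zero_iff.2 (entry_norm_bound_of_unitary hU.1 i j))
  exact isClosed_unitary.inter (isClosed_singleton.preimage continuous_id.matrix_det)

@[fun_prop]
theorem continuous_matrix_exp : Continuous (exp : Matrix n n ℂ → Matrix n n ℂ) :=
  letI : NormedAlgebra ℚ (Matrix n n ℂ) := NormedAlgebra.restrictScalars ℚ ℂ _
  NormedSpace.exp_continuous

theorem exp_mem_unitaryGroup {X : Matrix n n ℂ} (hX : Xᴴ = -X) : exp X ∈ unitaryGroup n ℂ := by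
  rw [mem_unitaryGroup_iff', NormedSpace.star_exp, star_eq_conjTranspose, hX,
    ← Matrix.exp_add_of_commute _ _ (Commute.refl X).neg_left, neg_add_cancel, NormedSpace.exp_zero]

theorem det_exp_of_skew {X : Matrix n n ℂ} (hX : Xᴴ = -X) :
    (exp X).det = Complex.exp X.trace := by
  have hH : (Complex.I • X).IsHermitian := by
    rw [IsHermitian, conjTranspose_smul, hX, Complex.star_def, Complex.conj_I, neg_smul_neg]
  set U : Matrix n n ℂ := hH.eigenvectorUnitary.1
  set v : n → ℂ := fun k => -Complex.I * (hH.eigenvalues k : ℂ)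
  have hU : U * star U = 1 := Unitary.mul_star_self_of_mem hH.eigenvectorUnitary.2
  have hUunit : IsUnit U := IsUnit.of_mul_eq_one _ hU
  have hdet : IsUnit U.det := (isUnit_iff_isUnit_det _).1 hUunit
  have hXdiag : X = U * diagonal v * U⁻¹ := by
    have hspec := hH.spectral_theorem
    rw [Unitary.conjStarAlgAut_apply] at hspec
    have hv : diagonal v = (-Complex.I) • diagonal (RCLike.ofReal ∘ hH.eigenvalues) := by
      rw [← diagonal_smul]
      rfl
    calc X = (-Complex.I) • (Complex.I • X) := by simp [smul_smul]
      _ = U * diagonal v * U⁻¹ := by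
        rw [hspec, inv_eq_right_inv hU, hv, mul_smul_comm, smul_mul_assoc]
  rw [hXdiag, Matrix.exp_conj _ _ hUunit, det_conj hUunit, Matrix.exp_diagonal, det_diagonal,
    trace_mul_comm, nonsing_inv_mul_cancel_left _ _ hdet, trace_diagonal, Complex.exp_sum]
  refine Finset.prod_congr rfl fun k _ => ?_
  rw [Pi.coe_exp, Complex.exp_eq_exp_ℂ]

theorem exists_skew_exp_eq {U : Matrix n n ℂ} (hU : U ∈ unitaryGroup n ℂ) :
    ∃ X : Matrix n n ℂ, Xᴴ = -X ∧ exp X = U := by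
  have hcont : ∀ f : ℂ → ℂ, ContinuousOn f (spectrum ℂ U) := fun f =>
    (Matrix.finite_spectrum U).continuousOn f
  have hnormal : IsStarNormal U := ⟨hU.1.trans hU.2.symm⟩
  have hargskew : (Complex.I • cfc (Complex.ofReal ∘ Complex.arg : ℂ → ℂ) U)ᴴ =
      -(Complex.I • cfc (Complex.ofReal ∘ Complex.arg : ℂ → ℂ) U) := by
    rw [conjTranspose_smul, ← star_eq_conjTranspose, (IsSelfAdjoint.cfc_arg U).star_eq,
      Complex.star_def, Complex.conj_I, neg_smul]
  refine ⟨_, hargskew, ?_⟩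
  rw [← cfc_smul Complex.I _ U (hcont _), ← CFC.complex_exp_eq_normedSpace_exp (cfc_predicate _ U),
    ← cfc_comp' Complex.exp _ U Complex.continuous_exp.continuousOn (hcont _)]
  conv_rhs => rw [← cfc_id' ℂ U]
  refine cfc_congr fun z hz => ?_
  have hz1 : ‖z‖ = 1 := spectrum.norm_eq_one_of_unitary hU hz
  simpa [hz1, mul_comm] using Complex.norm_mul_exp_arg_mul_I z

theorem exp_mul_exp_mem_specialUnitaryGroup {X Y : Matrix n n ℂ} (hX : Xᴴ = -X) (hY : Yᴴ = -Y)
    (htrace : X.trace + Y.trace = 0) : exp X * exp Y ∈ specialUnitaryGroup n ℂ :=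
  ⟨mul_mem (exp_mem_unitaryGroup hX) (exp_mem_unitaryGroup hY), by
    change (exp X * exp Y).det = 1
    rw [det_mul, det_exp_of_skew hX, det_exp_of_skew hY, ← Complex.exp_add, htrace,
      Complex.exp_zero]⟩

theorem exp_mem_specialUnitaryGroup {X : Matrix n n ℂ} (hX : Xᴴ = -X) (htrace : X.trace = 0) :
    exp X ∈ specialUnitaryGroup n ℂ :=
  ⟨exp_mem_unitaryGroup hX, by
    change (exp X).det = 1
    rw [det_exp_of_skew hX, htrace, Complex.exp_zero]⟩

/-- The one-entry diagonal matrix with entry `2πim` corrects the trace of a logarithm without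
changing its exponential. -/
theorem exists_skew_trace_eq_exp_eq_one [Nonempty n] {z : ℂ} (hz : Complex.exp z = 1) :
    ∃ D : Matrix n n ℂ, Dᴴ = -D ∧ D.trace = z ∧ exp D = 1 := by
  obtain ⟨o⟩ := ‹Nonempty n›
  obtain ⟨m, rfl⟩ := Complex.exp_eq_one_iff.1 hz
  refine ⟨diagonal (Pi.single o (m * (2 * Real.pi * Complex.I))), ?_, by simp, ?_⟩
  · rw [diagonal_conjTranspose, diagonal_neg, ← Pi.single_star]
    simp [Pi.single_neg]
  · rw [Matrix.exp_diagonal, ← diagonal_one]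
    congr 1
    ext k
    rw [Pi.coe_exp, ← Complex.exp_eq_exp_ℂ]
    rcases eq_or_ne k o with rfl | hk
    · simp [hz]
    · simp [hk]

instance : PathConnectedSpace (specialUnitaryGroup n ℂ) := by
  rcases isEmpty_or_nonempty n with _ | _
  · infer_instance
  suffices h : ∀ U : specialUnitaryGroup n ℂ, Joined 1 U from
    ⟨⟨1⟩, fun U V => (h U).symm.trans (h V)⟩
  intro U
  obtain ⟨Z, hZ, hZU⟩ := exists_skew_exp_eq U.2.1
  have hexp : Complex.exp Z.trace = 1 := by
    rw [← det_exp_of_skew hZ, hZU]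
    exact U.2.2
  obtain ⟨D, hD, hDtrace, hD1⟩ := exists_skew_trace_eq_exp_eq_one (n := n) hexp
  have hskew : ∀ {X : Matrix n n ℂ}, Xᴴ = -X → ∀ t : ℝ, (t • X)ᴴ = -(t • X) := fun hX t => by
    rw [conjTranspose_smul, hX, star_trivial, smul_neg]
  have hmem : ∀ t : ℝ, exp (t • Z) * exp (t • -D) ∈ specialUnitaryGroup n ℂ := fun t =>
    exp_mul_exp_mem_specialUnitaryGroup (hskew hZ t) (hskew (by rw [conjTranspose_neg, hD]) t)
      (by rw [← trace_add, ← smul_add, trace_smul, trace_add, trace_neg, hDtrace, add_neg_cancel,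
        smul_zero])
  have hcont : Continuous fun t : ℝ => exp (t • Z) * exp (t • -D) := by fun_prop
  exact ⟨⟨⟨fun t => ⟨_, hmem t⟩, (hcont.comp continuous_subtype_val).subtype_mk _⟩,
    Subtype.ext (by simp), Subtype.ext (by simp [Matrix.exp_neg, hD1, hZU])⟩⟩

end SpecialUnitaryGroup

section LocalLogarithm

theorem exists_local_log (𝔸 : Type*) [NormedRing 𝔸] [NormedAlgebra ℝ 𝔸] [CompleteSpace 𝔸] :
    ∃ log : 𝔸 → 𝔸, HasStrictFDerivAt log (.id ℝ 𝔸) 1 ∧ log 1 = 0 ∧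
      (∀ᶠ x in 𝓝 0, log (exp x) = x) ∧ ∀ᶠ y in 𝓝 1, exp (log y) = y := by
  have hexp : HasStrictFDerivAt exp
      (ContinuousLinearEquiv.refl ℝ 𝔸 : 𝔸 →L[ℝ] 𝔸) (0 : 𝔸) := hasStrictFDerivAt_exp_zero
  refine ⟨hexp.localInverse exp _ 0, ?_, ?_, hexp.eventually_left_inverse, ?_⟩
  · simpa using hexp.to_localInverse
  · simpa using hexp.localInverse_apply_image
  · simpa using hexp.eventually_right_inverse

variable {n : Type*} [Fintype n] [DecidableEq n] {N : ℕ}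

theorem exp_neg_eq_exp_conjTranspose {X : Matrix n n ℂ} (hX : exp X ∈ unitaryGroup n ℂ) :
    exp (-X) = exp Xᴴ := by
  have hinv : exp (-X) * exp X = 1 := by
    rw [← Matrix.exp_add_of_commute _ _ (Commute.refl X).neg_left, neg_add_cancel,
      NormedSpace.exp_zero]
  rw [Matrix.exp_conjTranspose]
  exact left_inv_eq_right_inv hinv hX.2

theorem trace_eq_zero_of_norm_trace_lt {X : Matrix n n ℂ} (hX : Xᴴ = -X)
    (hdet : (exp X).det = 1) (hlt : ‖X.trace‖ < 2 * Real.pi) : X.trace = 0 := by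
  rw [det_exp_of_skew hX, Complex.exp_eq_one_iff] at hdet
  obtain ⟨m, hm⟩ := hdet
  have hnorm : ‖X.trace‖ = |(m : ℝ)| * (2 * Real.pi) := by
    rw [hm]
    simp [abs_of_pos Real.pi_pos]
  have hm1 : |(m : ℝ)| < 1 := by nlinarith [Real.pi_pos]
  have hm0 : m = 0 := Int.abs_lt_one_iff.1 (by exact_mod_cast hm1)
  simp [hm, hm0]

theorem eventually_log_mem_su {log : Matrix (Fin N) (Fin N) ℂ → Matrix (Fin N) (Fin N) ℂ}
    (hcont : ContinuousAt log 1) (hlog1 : log 1 = 0) (hlog_exp : ∀ᶠ X in 𝓝 0, log (exp X) = X)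
    (hexp_log : ∀ᶠ U in 𝓝 1, exp (log U) = U) :
    ∀ᶠ U : specialUnitaryGroup (Fin N) ℂ in 𝓝 1, log U ∈ su N := by
  have hcoe : Tendsto (fun U : specialUnitaryGroup (Fin N) ℂ =>
      (U : Matrix (Fin N) (Fin N) ℂ)) (𝓝 1) (𝓝 1) := continuous_subtype_val.continuousAt
  have hlim : Tendsto (fun U : specialUnitaryGroup (Fin N) ℂ => log U) (𝓝 1) (𝓝 0) :=
    hlog1 ▸ hcont.tendsto.comp hcoe
  have hneg := hlim.neg
  have hstar := hlim.star
  have htrace := ((continuous_id.matrix_trace.tendsto _).comp hlim).norm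
  rw [neg_zero] at hneg
  rw [star_zero] at hstar
  rw [id, trace_zero, norm_zero] at htrace
  filter_upwards [hcoe.eventually hexp_log, hneg.eventually hlog_exp, hstar.eventually hlog_exp,
    htrace.eventually (gt_mem_nhds Real.two_pi_pos)] with U hU hU_neg hU_star hU_trace
  have hmem : exp (log U) ∈ specialUnitaryGroup (Fin N) ℂ := hU.symm ▸ U.2
  have hskew : (log U)ᴴ = -log U := by
    rw [← hU_neg, exp_neg_eq_exp_conjTranspose hmem.1]
    exact hU_star.symm
  exact ⟨hskew, trace_eq_zero_of_norm_trace_lt hskew hmem.2 hU_trace⟩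

end LocalLogarithm

section OpenMapping

variable {N : ℕ}

theorem exists_chart_at_one (N : ℕ) :
    ∃ (c : Matrix (Fin N) (Fin N) ℂ → (suLie N).toSubmodule)
      (c' : Matrix (Fin N) (Fin N) ℂ →L[ℝ] (suLie N).toSubmodule),
      HasStrictFDerivAt c c' 1 ∧ (∀ X : (suLie N).toSubmodule, c' X = X) ∧
      ∃ V ∈ 𝓝 (1 : specialUnitaryGroup (Fin N) ℂ),
        Set.InjOn (fun U : specialUnitaryGroup (Fin N) ℂ => c U) V := by
  obtain ⟨log, hlog, hlog1, hlog_exp, hexp_log⟩ := exists_local_log (Matrix (Fin N) (Fin N) ℂ)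
  obtain ⟨p, hp⟩ := (suLie N).toSubmodule.subtype.exists_leftInverse_of_injective
    (Submodule.ker_subtype _)
  have hp' : ∀ X : (suLie N).toSubmodule, p X = X := LinearMap.congr_fun hp
  refine ⟨p.toContinuousLinearMap ∘ log, p.toContinuousLinearMap, ?_, hp', _,
    inter_mem (eventually_log_mem_su hlog.continuousAt hlog1 hlog_exp hexp_log)
      (continuous_subtype_val.continuousAt.eventually hexp_log), ?_⟩
  · exact p.toContinuousLinearMap.hasStrictFDerivAt.comp 1 hlog
  · rintro U ⟨hU, hexpU⟩ U' ⟨hU', hexpU'⟩ hc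
    have hlogeq : log U = log U' := by
      have := congrArg Subtype.val
        ((hp' ⟨log U, hU⟩).symm.trans (hc.trans (hp' ⟨log U', hU'⟩)))
      exact this
    exact Subtype.ext (hexpU.symm.trans ((congrArg exp hlogeq).trans hexpU'))

theorem nhds_le_map_of_hasStrictFDerivAt {F : Type*} [NormedAddCommGroup F] [NormedSpace ℝ F]
    [CompleteSpace F] {φ : F → specialUnitaryGroup (Fin N) ℂ}
    {φ' : F →L[ℝ] Matrix (Fin N) (Fin N) ℂ} {x : F}
    (hφ : HasStrictFDerivAt (fun y => (φ y : Matrix (Fin N) (Fin N) ℂ)) φ' x)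
    (hsurj : ∀ X ∈ su N, ∃ v, φ' v = φ x * X) : 𝓝 (φ x) ≤ map φ (𝓝 x) := by
  obtain ⟨c, c', hc, hc', V, hV, hinj⟩ := exists_chart_at_one N
  have hone : (((φ x)⁻¹ * φ x : specialUnitaryGroup (Fin N) ℂ) : Matrix (Fin N) (Fin N) ℂ) = 1 :=
    congrArg Subtype.val (inv_mul_cancel (φ x))
  have hderiv : HasStrictFDerivAt (fun y => c ((φ x)⁻¹ * φ y : specialUnitaryGroup (Fin N) ℂ))
      (c' ∘L ContinuousLinearMap.mul ℝ _ ((φ x)⁻¹).1 ∘L φ') x :=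
    HasStrictFDerivAt.comp x (hone ▸ hc)
      ((ContinuousLinearMap.mul ℝ _ ((φ x)⁻¹).1).hasStrictFDerivAt.comp x hφ)
  have hrange : (c' ∘L ContinuousLinearMap.mul ℝ _ ((φ x)⁻¹).1 ∘L φ').range = ⊤ := by
    refine LinearMap.range_eq_top.2 fun X => ?_
    obtain ⟨v, hv⟩ := hsurj X X.2
    refine ⟨v, ?_⟩
    have hcancel : ((φ x)⁻¹).1 * φ' v = X := by
      rw [hv, ← mul_assoc, ← Submonoid.coe_mul, hone, one_mul]
    change c' (((φ x)⁻¹).1 * φ' v) = X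
    rw [hcancel, hc']
  have hmap := hderiv.map_nhds_eq_of_surj hrange
  have hcont : ContinuousAt φ x := IsInducing.subtypeVal.continuousAt_iff.2 hφ.continuousAt
  have hV' : ∀ᶠ U in 𝓝 (φ x), (φ x)⁻¹ * U ∈ V :=
    (continuous_const_mul (φ x)⁻¹).tendsto' _ _ (inv_mul_cancel _) hV
  intro s hs
  have hchart : ContinuousAt
      (fun U => c ((φ x)⁻¹ * U : specialUnitaryGroup (Fin N) ℂ)) (φ x) :=
    ContinuousAt.comp (f := fun U => (((φ x)⁻¹ * U : specialUnitaryGroup (Fin N) ℂ) :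
      Matrix (Fin N) (Fin N) ℂ)) (hone ▸ hc.continuousAt) (by fun_prop)
  have himage := hchart.eventually
    (hmap ▸ image_mem_map (inter_mem (mem_map.1 hs) (hcont.eventually hV')))
  filter_upwards [himage, hV'] with U ⟨y, ⟨hys, hyV⟩, hyU⟩ hUV
  exact mul_left_cancel (hinj hyV hUV hyU) ▸ hys

end OpenMapping

section LieClosure

theorem lieSpan_toSubmodule_le {R L : Type*} [CommRing R] [LieRing L] [LieAlgebra R L] {s : Set L}
    {V : Submodule R L} (hs : s ⊆ V) (hlie : ∀ x ∈ s, ∀ v ∈ V, ⁅x, v⁆ ∈ V) :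
    (LieSubalgebra.lieSpan R L s).toSubmodule ≤ V := by
  let stabilizer : LieSubalgebra R L :=
    { carrier := {x | ∀ v ∈ V, ⁅x, v⁆ ∈ V}
      zero_mem' := fun v _ => by simp
      add_mem' := fun {x y} hx hy v hv => (add_lie x y v).symm ▸ V.add_mem (hx v hv) (hy v hv)
      smul_mem' := fun r x hx v hv => (smul_lie r x v).symm ▸ V.smul_mem r (hx v hv)
      lie_mem' := fun {x y} hx hy v hv =>
        (lie_lie x y v).symm ▸ V.sub_mem (hx _ (hy v hv)) (hy _ (hx v hv)) }
  have hstab : LieSubalgebra.lieSpan R L s ≤ stabilizer := LieSubalgebra.lieSpan_le.2 hlie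
  intro x hx
  induction hx using LieSubalgebra.lieSpan_induction with
  | mem x hx => exact hs hx
  | zero => exact V.zero_mem
  | add x y _ _ hx hy => exact V.add_mem hx hy
  | smul r x _ hx => exact V.smul_mem r hx
  | lie x y hx _ _ hy => exact hstab hx y hy

theorem lie_mem_of_exp_conj_mem {𝔸 : Type*} [NormedRing 𝔸] [NormedAlgebra ℝ 𝔸] [CompleteSpace 𝔸]
    {V : Submodule ℝ 𝔸} (hV : IsClosed (V : Set 𝔸)) {x y : 𝔸}
    (h : ∀ t : ℝ, 0 ≤ t → exp (t • -x) * y * exp (t • x) ∈ V) : ⁅x, y⁆ ∈ V := by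
  have hexp : ∀ z : 𝔸, HasDerivAt (fun t : ℝ => exp (t • z)) z 0 := fun z => by
    simpa using hasDerivAt_exp_smul_const' (𝕂 := ℝ) z 0
  have hconj : HasDerivAt (fun t : ℝ => exp (t • -x) * y * exp (t • x)) (-⁅x, y⁆) 0 := by
    refine (((hexp (-x)).mul_const y).mul (hexp x)).congr_deriv ?_
    simp only [zero_smul, NormedSpace.exp_zero, one_mul, mul_one, neg_mul, Ring.lie_def]
    abel
  refine V.neg_mem_iff.1 (hV.mem_of_tendsto hconj.tendsto_slope_zero_right ?_)
  filter_upwards [self_mem_nhdsWithin] with t ht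
  rw [zero_add]
  exact V.smul_mem _ (V.sub_mem (h t (Set.mem_Ioi.1 ht).le) (h 0 le_rfl))

end LieClosure

section FlowMonoid

variable {N : ℕ} {Γ : Set (Matrix (Fin N) (Fin N) ℂ)} {X Y : Matrix (Fin N) (Fin N) ℂ}
  {g q : specialUnitaryGroup (Fin N) ℂ}

/-- The adjoint action `X ↦ g X g⁻¹` of `SU(N)` on matrices. -/
noncomputable def adjointAction :
    specialUnitaryGroup (Fin N) ℂ →* Module.End ℝ (Matrix (Fin N) (Fin N) ℂ) where
  toFun g := LinearMap.mulLeftRight ℝ (g.1, (g⁻¹).1)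
  map_one' := by ext1; simp
  map_mul' g q := by ext1; simp [mul_assoc]

theorem adjointAction_apply (g : specialUnitaryGroup (Fin N) ℂ) (X : Matrix (Fin N) (Fin N) ℂ) :
    adjointAction g X = g * X * (g⁻¹ : specialUnitaryGroup (Fin N) ℂ) := rfl

theorem adjointAction_inv_adjointAction (g : specialUnitaryGroup (Fin N) ℂ)
    (X : Matrix (Fin N) (Fin N) ℂ) : adjointAction g⁻¹ (adjointAction g X) = X := by
  rw [← Module.End.mul_apply, ← map_mul, inv_mul_cancel, map_one, Module.End.one_apply]

theorem mul_adjointAction_inv (g : specialUnitaryGroup (Fin N) ℂ)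
    (X : Matrix (Fin N) (Fin N) ℂ) : g * adjointAction g⁻¹ X = X * g := by
  rw [adjointAction_apply, inv_inv, ← mul_assoc, ← mul_assoc, ← Submonoid.coe_mul, mul_inv_cancel,
    Submonoid.coe_one, one_mul]

theorem adjointAction_mem_su (g : specialUnitaryGroup (Fin N) ℂ) (hX : X ∈ su N) :
    adjointAction g X ∈ su N := by
  have hinv : ((g⁻¹ : specialUnitaryGroup (Fin N) ℂ) : Matrix (Fin N) (Fin N) ℂ) =
      (g : Matrix (Fin N) (Fin N) ℂ)ᴴ := rfl
  constructor
  · rw [adjointAction_apply, hinv]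
    simp only [conjTranspose_mul, conjTranspose_conjTranspose, hX.1, mul_neg, neg_mul, mul_assoc]
  · rw [adjointAction_apply, trace_mul_comm, ← mul_assoc, ← Submonoid.coe_mul, inv_mul_cancel,
      Submonoid.coe_one, one_mul, hX.2]

/-- The one-parameter subgroup `t ↦ exp (t X)` of `SU(N)` generated by `X ∈ su(N)`. -/
noncomputable def flow (hX : X ∈ su N) (t : ℝ) : specialUnitaryGroup (Fin N) ℂ :=
  ⟨exp (t • X), exp_mem_specialUnitaryGroup ((suLie N).smul_mem t hX).1
    ((suLie N).smul_mem t hX).2⟩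

theorem coe_flow (hX : X ∈ su N) (t : ℝ) : (flow hX t : Matrix (Fin N) (Fin N) ℂ) = exp (t • X) :=
  rfl

theorem flow_zero (hX : X ∈ su N) : flow hX 0 = 1 :=
  Subtype.ext (by rw [coe_flow, zero_smul, NormedSpace.exp_zero, Submonoid.coe_one])

/-- The monoid generated by the forward flows `exp (t X)`, `t ≥ 0`, of the directions `X ∈ Γ`. -/
def flowMonoid (Γ : Set (Matrix (Fin N) (Fin N) ℂ)) : Submonoid (specialUnitaryGroup (Fin N) ℂ) :=
  Submonoid.closure
    {g | ∃ t : ℝ, 0 ≤ t ∧ ∃ X ∈ Γ, (g : Matrix (Fin N) (Fin N) ℂ) = exp (t • X)}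

theorem flow_mem_flowMonoid (hX : X ∈ su N) (hXΓ : X ∈ Γ) {t : ℝ} (ht : 0 ≤ t) :
    flow hX t ∈ flowMonoid Γ :=
  Submonoid.subset_closure ⟨t, ht, X, hXΓ, rfl⟩

/-- The span of the directions in `Γ`, transported by the adjoint action of the inverses of the
elements of the flow monoid. -/
noncomputable def transportedSpan (Γ : Set (Matrix (Fin N) (Fin N) ℂ)) :
    Submodule ℝ (Matrix (Fin N) (Fin N) ℂ) :=
  Submodule.span ℝ {Y | ∃ g ∈ flowMonoid Γ, ∃ X ∈ Γ, adjointAction g⁻¹ X = Y}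

theorem subset_transportedSpan : Γ ⊆ transportedSpan Γ := fun X hX =>
  Submodule.subset_span ⟨1, one_mem _, X, hX, by simp⟩

theorem adjointAction_inv_mem_transportedSpan (hg : g ∈ flowMonoid Γ) (hY : Y ∈ transportedSpan Γ) :
    adjointAction g⁻¹ Y ∈ transportedSpan Γ := by
  suffices transportedSpan Γ ≤ (transportedSpan Γ).comap (adjointAction g⁻¹) from this hY
  refine Submodule.span_le.2 ?_
  rintro _ ⟨q, hq, X, hX, rfl⟩
  refine Submodule.subset_span ⟨q * g, mul_mem hq hg, X, hX, ?_⟩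
  rw [_root_.mul_inv_rev, map_mul, Module.End.mul_apply]

theorem lie_mem_transportedSpan (hX : X ∈ su N) (hXΓ : X ∈ Γ) (hY : Y ∈ transportedSpan Γ) :
    ⁅X, Y⁆ ∈ transportedSpan Γ := by
  refine lie_mem_of_exp_conj_mem (Submodule.closed_of_finiteDimensional _) fun t ht => ?_
  have hflow := adjointAction_inv_mem_transportedSpan (flow_mem_flowMonoid hX hXΓ ht) hY
  have hstar : (((flow hX t)⁻¹ : specialUnitaryGroup (Fin N) ℂ) : Matrix (Fin N) (Fin N) ℂ) =
      exp (t • -X) := by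
    change star (exp (t • X)) = _
    rw [NormedSpace.star_exp, star_smul, star_trivial, star_eq_conjTranspose, hX.1]
  rwa [adjointAction_apply, inv_inv, hstar] at hflow

theorem lieSpan_le_transportedSpan (hΓ : Γ ⊆ su N) :
    (LieSubalgebra.lieSpan ℝ (Matrix (Fin N) (Fin N) ℂ) Γ).toSubmodule ≤ transportedSpan Γ :=
  lieSpan_toSubmodule_le subset_transportedSpan fun _ hX _ hY =>
    lie_mem_transportedSpan (hΓ hX) hX hY

/-- A strictly differentiable family in the submonoid `S` of `SU(N)` passes through `g`, and its
derivative there attains every direction of the left translate `g W`. -/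
def HasLocalParam (S : Submonoid (specialUnitaryGroup (Fin N) ℂ))
    (g : specialUnitaryGroup (Fin N) ℂ) (W : Submodule ℝ (Matrix (Fin N) (Fin N) ℂ)) : Prop :=
  ∃ (F : Type) (_ : NormedAddCommGroup F) (_ : NormedSpace ℝ F) (_ : CompleteSpace F) (x : F)
    (φ : F → specialUnitaryGroup (Fin N) ℂ) (φ' : F →L[ℝ] Matrix (Fin N) (Fin N) ℂ),
    HasStrictFDerivAt (fun y => (φ y : Matrix (Fin N) (Fin N) ℂ)) φ' x ∧ φ x = g ∧
      (∀ᶠ y in 𝓝 x, φ y ∈ S) ∧ ∀ w ∈ W, ∃ v, φ' v = g * w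

namespace HasLocalParam

variable {S : Submonoid (specialUnitaryGroup (Fin N) ℂ)}
  {W : Submodule ℝ (Matrix (Fin N) (Fin N) ℂ)}

theorem one_bot (S : Submonoid (specialUnitaryGroup (Fin N) ℂ)) : HasLocalParam S 1 ⊥ :=
  ⟨ℝ, inferInstance, inferInstance, inferInstance, 0, fun _ => 1, 0, hasStrictFDerivAt_const _ _,
    rfl, .of_forall fun _ => S.one_mem, fun w hw => ⟨0, by simp [(Submodule.mem_bot ℝ).1 hw]⟩⟩

theorem mul_left (h : HasLocalParam S g W) (hq : q ∈ S) : HasLocalParam S (q * g) W := by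
  obtain ⟨F, _, _, _, x, φ, φ', hφ, rfl, hS, hW⟩ := h
  refine ⟨F, inferInstance, inferInstance, inferInstance, x, fun y => q * φ y,
    ContinuousLinearMap.mul ℝ _ q.1 ∘L φ',
    (ContinuousLinearMap.mul ℝ _ q.1).hasStrictFDerivAt.comp x hφ, rfl,
    hS.mono fun y hy => S.mul_mem hq hy, fun w hw => ?_⟩
  obtain ⟨v, hv⟩ := hW w hw
  exact ⟨v, by simp [hv, mul_assoc]⟩

theorem flow_mul (h : HasLocalParam (flowMonoid Γ) g W) (hX : X ∈ su N) (hXΓ : X ∈ Γ) :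
    HasLocalParam (flowMonoid Γ) (flow hX 1 * g) (W ⊔ Submodule.span ℝ {adjointAction g⁻¹ X}) := by
  obtain ⟨F, _, _, _, x, φ, φ', hφ, rfl, hS, hW⟩ := h
  have hexp : HasStrictFDerivAt (fun p : F × ℝ => exp (p.2 • X))
      ((ContinuousLinearMap.snd ℝ F ℝ).smulRight (exp X * X)) (x, 1) := by
    have hderiv : HasStrictDerivAt (fun t : ℝ => exp (t • X)) (exp X * X) (x, (1 : ℝ)).2 := by
      simpa using hasStrictDerivAt_exp_smul_const (𝕂 := ℝ) X 1
    exact (hderiv.hasStrictFDerivAt.comp (x, (1 : ℝ)) hasStrictFDerivAt_snd).congr_fderiv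
      (by ext <;> simp)
  have hfst : HasStrictFDerivAt (fun p : F × ℝ => (φ p.1 : Matrix (Fin N) (Fin N) ℂ))
      (φ' ∘L ContinuousLinearMap.fst ℝ F ℝ) (x, 1) :=
    HasStrictFDerivAt.comp (f := Prod.fst) (x, (1 : ℝ)) hφ hasStrictFDerivAt_fst
  refine ⟨F × ℝ, inferInstance, inferInstance, inferInstance, (x, 1),
    fun p => flow hX p.2 * φ p.1, _, hexp.mul' hfst, rfl, ?_, fun w hw => ?_⟩
  · have htime : ∀ᶠ p : F × ℝ in 𝓝 (x, 1), 0 < p.2 :=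
      continuous_snd.continuousAt.eventually (lt_mem_nhds zero_lt_one)
    filter_upwards [continuous_fst.continuousAt.eventually hS, htime] with p hp ht
    exact mul_mem (flow_mem_flowMonoid hX hXΓ ht.le) hp
  · obtain ⟨w, hwW, _, hc, rfl⟩ := Submodule.mem_sup.1 hw
    obtain ⟨c, rfl⟩ := Submodule.mem_span_singleton.1 hc
    obtain ⟨v, hv⟩ := hW w hwW
    refine ⟨(v, c), ?_⟩
    calc _ = exp X * φ' v + c • (exp X * (X * φ x)) := by
          simp [mul_assoc]
      _ = _ := by
          rw [hv, ← mul_adjointAction_inv, Submonoid.coe_mul, coe_flow, one_smul, mul_assoc,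
            mul_add, mul_smul_comm, mul_add, mul_smul_comm]

theorem mem (h : HasLocalParam S g W) : g ∈ S := by
  obtain ⟨F, _, _, _, x, φ, φ', -, rfl, hS, -⟩ := h
  exact hS.self_of_nhds

theorem interior_nonempty (h : HasLocalParam S g W) (hW : su N ⊆ W) :
    (interior (S : Set (specialUnitaryGroup (Fin N) ℂ))).Nonempty := by
  obtain ⟨F, _, _, _, x, φ, φ', hφ, rfl, hS, hφW⟩ := h
  exact ⟨φ x, mem_interior_iff_mem_nhds.2
    (nhds_le_map_of_hasStrictFDerivAt hφ (fun X hX => hφW X (hW hX)) hS)⟩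

end HasLocalParam

theorem exists_maximal_hasLocalParam (hΓ : Γ ⊆ su N) :
    ∃ (g : specialUnitaryGroup (Fin N) ℂ) (W : Submodule ℝ (Matrix (Fin N) (Fin N) ℂ)),
      HasLocalParam (flowMonoid Γ) g W ∧
        ∀ q ∈ flowMonoid Γ, ∀ X ∈ Γ, adjointAction (q * g)⁻¹ X ∈ W := by
  obtain ⟨W, ⟨g, hg⟩, hmax⟩ := WellFounded.has_min
    (wellFounded_gt (α := Submodule ℝ (Matrix (Fin N) (Fin N) ℂ)))
    {W | ∃ g, HasLocalParam (flowMonoid Γ) g W} ⟨⊥, 1, .one_bot _⟩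
  refine ⟨g, W, hg, fun q hq X hX => ?_⟩
  have hsup := eq_of_le_of_not_lt le_sup_left
    (hmax _ ⟨_, (hg.mul_left hq).flow_mul (hΓ hX) hX⟩)
  rw [hsup]
  exact Submodule.mem_sup_right (Submodule.mem_span_singleton_self _)

theorem exists_hasLocalParam_su_subset (hΓ : Γ ⊆ su N)
    (hrank : suLie N ≤ LieSubalgebra.lieSpan ℝ (Matrix (Fin N) (Fin N) ℂ) Γ) :
    ∃ (g : specialUnitaryGroup (Fin N) ℂ) (W : Submodule ℝ (Matrix (Fin N) (Fin N) ℂ)),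
      HasLocalParam (flowMonoid Γ) g W ∧ su N ⊆ W := by
  obtain ⟨g, W, hg, hW⟩ := exists_maximal_hasLocalParam hΓ
  refine ⟨g, W, hg, fun X hX => ?_⟩
  have hcomap : transportedSpan Γ ≤ W.comap (adjointAction g⁻¹) := by
    refine Submodule.span_le.2 ?_
    rintro _ ⟨q, hq, Y, hY, rfl⟩
    rw [SetLike.mem_coe, Submodule.mem_comap, ← Module.End.mul_apply, ← map_mul,
      ← _root_.mul_inv_rev]
    exact hW q hq Y hY
  rw [← adjointAction_inv_adjointAction g X]
  exact hcomap (lieSpan_le_transportedSpan hΓ (hrank (adjointAction_mem_su g hX)))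

theorem flowMonoid_eq_top (hΓ : Γ ⊆ su N)
    (hrank : suLie N ≤ LieSubalgebra.lieSpan ℝ (Matrix (Fin N) (Fin N) ℂ) Γ) :
    flowMonoid Γ = ⊤ := by
  obtain ⟨g, W, hg, hW⟩ := exists_hasLocalParam_su_subset hΓ hrank
  exact submonoid_eq_top_of_interior_nonempty (hg.interior_nonempty hW)

end FlowMonoid

section Reachability

variable {N : ℕ} {A B X : Matrix (Fin N) (Fin N) ℂ}

theorem continuous_flow (hX : X ∈ su N) : Continuous (flow hX) := by
  have hcont : Continuous fun t : ℝ => exp (t • X) := by fun_prop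
  exact hcont.subtype_mk _

theorem hasDerivAt_flow_mul_apply (hX : X ∈ su N) (g : specialUnitaryGroup (Fin N) ℂ)
    (T t : ℝ) (i j : Fin N) :
    HasDerivAt (fun s : ℝ => (flow hX (s - T) * g : specialUnitaryGroup (Fin N) ℂ).1 i j)
      ((X * (flow hX (t - T) * g : specialUnitaryGroup (Fin N) ℂ).1) i j) t := by
  have hderiv : HasDerivAt (fun s : ℝ => exp ((s - T) • X) * g.1)
      (X * (exp ((t - T) • X) * g.1)) t := by
    rw [← mul_assoc]
    exact ((hasDerivAt_exp_smul_const' (𝕂 := ℝ) X (t - T)).comp_sub_const t T).mul_const g.1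
  exact (entryLinearMap ℝ ℂ i j).toContinuousLinearMap.hasFDerivAt.comp_hasDerivAt t hderiv

theorem IsAdmissible.piecewise {u v : ℝ → ℝ} (hu : IsAdmissible u) (hv : IsAdmissible v) (T : ℝ) :
    IsAdmissible fun s => if s ≤ T then u s else v s := by
  obtain ⟨S, hS⟩ := hu
  obtain ⟨R, hR⟩ := hv
  refine ⟨insert T (S ∪ R), fun s t hst h => ?_⟩
  have hT : T ∉ Set.Icc s t := h T (Finset.mem_insert_self _ _)
  by_cases ht : t ≤ T
  · simp only [ht, hst.trans ht, if_true]
    exact hS s t hst fun r hr => h r (Finset.mem_insert_of_mem (Finset.mem_union_left _ hr))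
  · have hs : ¬ s ≤ T := fun hs => hT ⟨hs, (not_le.1 ht).le⟩
    simp only [ht, hs, if_false]
    exact hR s t hst fun r hr => h r (Finset.mem_insert_of_mem (Finset.mem_union_right _ hr))

theorem isAdmissible_const (c : ℝ) : IsAdmissible fun _ => c := ⟨∅, fun _ _ _ _ => rfl⟩

theorem one_mem_reachableSet (A B : Matrix (Fin N) (Fin N) ℂ) :
    (1 : specialUnitaryGroup (Fin N) ℂ) ∈ reachableSet A B :=
  ⟨fun _ => 0, isAdmissible_const 0, 0, le_rfl, fun _ => 1,
    ⟨rfl, continuousOn_const, ∅, fun _ ht => absurd (ht.1.trans ht.2) (lt_irrefl _)⟩, rfl⟩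

theorem IsIntegralCurve.piecewise_flow {u : ℝ → ℝ} {T τ c : ℝ}
    {Y : ℝ → specialUnitaryGroup (Fin N) ℂ} (hY : IsIntegralCurve A B u T Y) (hT : 0 ≤ T)
    (hτ : 0 ≤ τ) (hX : A + c • B ∈ su N) :
    IsIntegralCurve A B (fun s => if s ≤ T then u s else c) (T + τ)
      (fun s => if s ≤ T then Y s else flow hX (s - T) * Y T) := by
  obtain ⟨hY0, hYcont, S, hYderiv⟩ := hY
  set Z : ℝ → specialUnitaryGroup (Fin N) ℂ := fun s =>
    if s ≤ T then Y s else flow hX (s - T) * Y T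
  have hZ_le : ∀ s ≤ T, Z s = Y s := fun s hs => if_pos hs
  have hZ_lt : ∀ s > T, Z s = flow hX (s - T) * Y T := fun s hs => if_neg (not_le.2 hs)
  refine ⟨(hZ_le 0 hT).trans hY0, ?_, insert T S, fun t ht htS i j => ?_⟩
  · rw [← Set.Icc_union_Icc_eq_Icc hT (le_add_of_nonneg_right hτ)]
    refine (hYcont.congr fun s hs => hZ_le s hs.2).union_of_isClosed (ContinuousOn.congr
      (f := fun s => flow hX (s - T) * Y T) ?_ fun s hs => ?_) isClosed_Icc isClosed_Icc
    · exact (((continuous_flow hX).comp (continuous_sub_right T)).mul_const (Y T)).continuousOn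
    · rcases hs.1.eq_or_lt with rfl | hs
      · simp [hZ_le, flow_zero]
      · exact hZ_lt s hs
  · rw [Finset.mem_insert, not_or] at htS
    rcases lt_or_gt_of_ne htS.1 with h | h
    · simp only [hZ_le t h.le, if_pos h.le]
      refine (hYderiv t ⟨ht.1, h⟩ htS.2 i j).congr_of_eventuallyEq ?_
      filter_upwards [gt_mem_nhds h] with s hs
      rw [hZ_le s (le_of_lt hs)]
    · simp only [hZ_lt t h, if_neg (not_le.2 h), Complex.coe_smul]
      refine (hasDerivAt_flow_mul_apply hX (Y T) T t i j).congr_of_eventuallyEq ?_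
      filter_upwards [lt_mem_nhds h] with s hs
      rw [hZ_lt s hs]

theorem flow_mul_mem_reachableSet {g : specialUnitaryGroup (Fin N) ℂ} {τ c : ℝ}
    (hg : g ∈ reachableSet A B) (hX : A + c • B ∈ su N) (hτ : 0 ≤ τ) :
    flow hX τ * g ∈ reachableSet A B := by
  obtain ⟨u, hu, T, hT, Y, hY, rfl⟩ := hg
  refine ⟨_, hu.piecewise (isAdmissible_const c) T, T + τ, add_nonneg hT hτ, _,
    hY.piecewise_flow hT hτ hX, ?_⟩
  rcases hτ.eq_or_lt with rfl | hτ
  · simp [flow_zero]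
  · simp [hτ]

theorem add_smul_mem_su (hA : A ∈ su N) (hB : B ∈ su N) (c : ℝ) : A + c • B ∈ su N :=
  (suLie N).add_mem hA ((suLie N).smul_mem c hB)

theorem flowMonoid_subset_reachableSet (hA : A ∈ su N) (hB : B ∈ su N) :
    (flowMonoid (Set.range fun c : ℝ => A + c • B) : Set (specialUnitaryGroup (Fin N) ℂ)) ⊆
      reachableSet A B := by
  intro g hg
  induction hg using Submonoid.closure_induction_left with
  | one => exact one_mem_reachableSet A B
  | mul_left q hq g _ hg =>
    obtain ⟨t, ht, _, ⟨c, rfl⟩, hq⟩ := hq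
    have hqflow : q = flow (add_smul_mem_su hA hB c) t := Subtype.ext hq
    exact hqflow ▸ flow_mul_mem_reachableSet hg _ ht

theorem lieSpan_pair_le_lieSpan_range {R L : Type*} [CommRing R] [LieRing L] [LieAlgebra R L]
    (x y : L) :
    LieSubalgebra.lieSpan R L {x, y} ≤
      LieSubalgebra.lieSpan R L (Set.range fun c : R => x + c • y) := by
  have hmem : ∀ c : R, x + c • y ∈ LieSubalgebra.lieSpan R L (Set.range fun c : R => x + c • y) :=
    fun c => LieSubalgebra.subset_lieSpan ⟨c, rfl⟩
  have hx := hmem 0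
  have hy := sub_mem (hmem 1) hx
  rw [zero_smul, add_zero] at hx
  rw [zero_smul, add_zero, one_smul, add_sub_cancel_left] at hy
  exact LieSubalgebra.lieSpan_le.2 (Set.pair_subset hx hy)

theorem isControllable_of_suLie_le_lieSpan (hA : A ∈ su N) (hB : B ∈ su N)
    (hrank : suLie N ≤ LieSubalgebra.lieSpan ℝ (Matrix (Fin N) (Fin N) ℂ) {A, B}) :
    IsControllable A B := by
  have htop := flowMonoid_eq_top (Set.range_subset_iff.2 (add_smul_mem_su hA hB))
    (hrank.trans (lieSpan_pair_le_lieSpan_range A B))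
  have hsub := flowMonoid_subset_reachableSet hA hB
  rw [htop] at hsub
  exact Set.univ_subset_iff.1 hsub

end Reachability

theorem mainTheorem8_general {N : ℕ} (E : Fin N → ℝ) (B : Matrix (Fin N) (Fin N) ℂ)
    (hE_trace : ∑ k, E k = 0) (hE_nondeg : Function.Injective E) (hB : B ∈ su N)
    (hG : (graph B).Connected) :
    levelTwoDiag (drift E) B = Complex.I • diagonal (fun k => (dEntry E B k : ℂ)) ∧
      (SeparatesEdges (graph B) E (levelTwoDiag (drift E) B) → IsControllable (drift E) B) :=
  ⟨levelTwoDiag_drift E hB.1, fun hsep =>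
    isControllable_of_suLie_le_lieSpan (drift_mem_su hE_trace) hB
      (suLie_le_lieSpan hE_trace hE_nondeg hB hG hsep)⟩

end QuantumControl

theorem mainTheorem8 {N : ℕ} (E : Fin N → ℝ) (B : Matrix (Fin N) (Fin N) ℂ)
    (hE_trace : ∑ k, E k = 0) (hE_order : Monotone E)
    (hE_nondeg : ∀ i j : Fin N, i ≠ j → E i ≠ E j)
    (hB : B ∈ QuantumControl.su N)
    (hG : (QuantumControl.graph B).Connected) :
    QuantumControl.levelTwoDiag (QuantumControl.drift E) B
        = Complex.I • Matrix.diagonal (fun k => (QuantumControl.dEntry E B k : ℂ)) ∧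
    (QuantumControl.IsRegular (QuantumControl.levelTwoDiag (QuantumControl.drift E) B) →
      QuantumControl.IsControllable (QuantumControl.drift E) B) ∧
    (QuantumControl.IsRegularAlong B
        (QuantumControl.levelTwoDiag (QuantumControl.drift E) B) →
      QuantumControl.IsControllable (QuantumControl.drift E) B) ∧
    (QuantumControl.IsRegularAlong (QuantumControl.levelOne (QuantumControl.drift E) B)
        (QuantumControl.levelTwoDiag (QuantumControl.drift E) B) →
      QuantumControl.IsControllable (QuantumControl.drift E) B) := by
  have hinj : Function.Injective E := fun i j => not_imp_not.1 (hE_nondeg i j)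
  have hmono : StrictMono E := hE_order.strictMono_of_injective hinj
  obtain ⟨hformula, hcontrol⟩ :=
    QuantumControl.mainTheorem8_general E B hE_trace hinj hB hG
  exact ⟨hformula, fun h => hcontrol (h.separatesEdges _ E),
    fun h => hcontrol (h.separatesEdges hB.1 hmono),
    fun h => hcontrol
      (((QuantumControl.isRegularAlong_levelOne_iff hinj).1 h).separatesEdges hB.1 hmono)⟩
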